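/- Let $F$ be a non-Archimedean local field of arbitrary characteristic, with absolute value $|\cdot|_F$ and ring of integers $\mathcal O_F$. Let $X$ be a smooth $F$-variety (a smooth, separated scheme of finite type over $F$), and regard $X(F)$ as an $F$-analytic manifold. A positive Borel measure $\mu$ on $X(F)$ is called smooth if for every $F$-analytic chart $\psi:V\to F^n$ defined on an open $V\subseteq X(F)$, the push-forward $\psi_*(\mu|_V)$ has on $\psi(V)$ a locally constant density with respect to the Haar measure on $F^n$ normalized by giving $\mathcal O_F^n$ volume $1$. For an open set $U\subseteq X(F)$ let $\mathcal M_c^\infty(U)$ be the set of smooth measures with compact support contained in $U$. For $F$-analytic functions $f_1,\dots,f_r:X(F)\to F$ generating an ideal $J$ and for $x_0\in X(F)$ put \[ \operatorname{lct}_F(J;x_0):=\sup\Big\{s\ge 0:\ \exists\, U\ni x_0 \text{ open such that } \forall \mu\in\mathcal M_c^\infty(U),\ \int \min_{1\le i\le r}|f_i(x)|_F^{-s}\,d\mu(x)<\infty\Big\}\in[0,\infty]. \] Let $\varphi_1,\dots,\varphi_r$ be regular functions on $X$ such that on every irreducible component of $X$ at least one $\varphi_i$ is not identically zero. Let $\varphi_{i,F}:X(F)\to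 F$ be the analytic function induced by $\varphi_i$, and let $J=\langle\varphi_{1,F},\dots,\varphi_{r,F}\rangle$. Then there exists $\epsilon>0$ such that for every $x_0\in X(F)$, \[ \operatorname{lct}_F(J;x_0)>\epsilon . \] -/

import Mathlib

open AlgebraicGeometry CategoryTheory MeasureTheory Topology
open scoped NNReal ENNReal

universe u v

noncomputable section

namespace AnalyticLct

/-! ### Smooth measures and the analytic log-canonical threshold

`F` is a non-Archimedean local field. An `F`-analytic manifold is given by a topological space `M`
with its maximal atlas `A`: for every `n`, the set `A n` of the analytic charts with values
in `F ^ n`. -/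

section Manifold

variable {F : Type u} [NontriviallyNormedField F] [LocallyCompactSpace F]
  [MeasurableSpace F] [BorelSpace F]
variable {M : Type v} [TopologicalSpace M]

/-- The compact neighbourhood `O_F ^ n` of `0` in `F ^ n` (which carries the sup norm). -/
def integerBox (F : Type u) [NontriviallyNormedField F] [LocallyCompactSpace F] (n : ℕ) :
    TopologicalSpace.PositiveCompacts (Fin n → F) where
  carrier := Metric.closedBall 0 1
  isCompact' := by
    have : ProperSpace F := ProperSpace.of_locallyCompactSpace F
    exact isCompact_closedBall _ _
  interior_nonempty' :=
    ⟨0, interior_mono Metric.ball_subset_closedBall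
      (by rw [Metric.isOpen_ball.interior_eq]; exact Metric.mem_ball_self one_pos)⟩

/-- The Haar measure on `F ^ n` for which `O_F ^ n` has volume `1`. -/
def haar (F : Type u) [NontriviallyNormedField F] [LocallyCompactSpace F]
    [MeasurableSpace F] [BorelSpace F] (n : ℕ) : Measure (Fin n → F) :=
  haveI : ProperSpace F := ProperSpace.of_locallyCompactSpace F
  Measure.addHaarMeasure (integerBox F n)

variable [MeasurableSpace M]

/-- A smooth measure: in every chart its push-forward has a locally constant (finite) density with
respect to the Haar measure. -/
def IsSmoothMeasure (A : ∀ n : ℕ, Set (OpenPartialHomeomorph M (Fin n → F)))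
    (μ : Measure M) : Prop :=
  ∀ n : ℕ, ∀ ψ ∈ A n, ∃ ρ : (Fin n → F) → ℝ≥0,
    (∀ y ∈ ψ.target, ∀ᶠ z in 𝓝 y, ρ z = ρ y) ∧
    (μ.restrict ψ.source).map ψ =
      ((haar F n).restrict ψ.target).withDensity fun y => (ρ y : ℝ≥0∞)

/-- `μ` has compact support contained in `U`. -/
def CompactlySupportedIn (μ : Measure M) (U : Set M) : Prop :=
  ∃ K : Set M, IsCompact K ∧ K ⊆ U ∧ μ Kᶜ = 0

/-- `min_i |f_i|^{-s}` is locally integrable at `x₀`, tested on the smooth measures with compact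
support in some open neighbourhood of `x₀`. In `ℝ≥0∞` one has `0 ^ (-s) = ∞` for `s > 0`. -/
def IntegrableNear (A : ∀ n : ℕ, Set (OpenPartialHomeomorph M (Fin n → F)))
    {r : ℕ} (f : Fin r → M → F) (x₀ : M) (s : ℝ≥0) : Prop :=
  ∃ U : Set M, IsOpen U ∧ x₀ ∈ U ∧ ∀ μ : Measure M,
    IsSmoothMeasure A μ → CompactlySupportedIn μ U →
      ∫⁻ x, ⨅ i, ‖f i x‖ₑ ^ (-(s : ℝ)) ∂μ < ∞

/-- The `F`-analytic log-canonical threshold at `x₀` of the ideal generated by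
`f 0, …, f (r - 1)`, as an element of `[0, ∞]`. -/
def lct (A : ∀ n : ℕ, Set (OpenPartialHomeomorph M (Fin n → F)))
    {r : ℕ} (f : Fin r → M → F) (x₀ : M) : ℝ≥0∞ :=
  sSup {t : ℝ≥0∞ | ∃ s : ℝ≥0, IntegrableNear A f x₀ s ∧ t = (s : ℝ≥0∞)}

end Manifold

/-! ### The `F`-analytic manifold `X(F)` -/

section Points

variable {F : Type u} [Field F] {X : Scheme.{u}}

/-- `X(F)`: the sections of the structure morphism `π : X ⟶ Spec F`. -/
def RatPoint (π : X ⟶ Spec (CommRingCat.of F)) : Type u :=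
  {x : Spec (CommRingCat.of F) ⟶ X // x ≫ π = 𝟙 _}

variable {π : X ⟶ Spec (CommRingCat.of F)}

/-- The rational point `x` lies in the Zariski open set `V`. -/
def RatPoint.MemOpen (x : RatPoint π) (V : X.Opens) : Prop := ⊤ ≤ x.1 ⁻¹ᵁ V

/-- The value in `F` of a regular function on `V` at a rational point of `V`. -/
def RatPoint.evalOn (x : RatPoint π) (V : X.Opens) (h : x.MemOpen V) (f : Γ(X, V)) : F :=
  (Scheme.ΓSpecIso (CommRingCat.of F)).hom.hom ((x.1.appLE V ⊤ h).hom f)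

open Classical in
/-- The function `V(F) → F` induced by a regular function on `V`, extended by `0` to `X(F)`. -/
def regVal (π : X ⟶ Spec (CommRingCat.of F)) (V : X.Opens) (f : Γ(X, V)) (x : RatPoint π) : F :=
  if h : x.MemOpen V then x.evalOn V h f else 0

end Points

section AnalyticStructure

variable {F : Type u} [NontriviallyNormedField F] {X : Scheme.{u}}

/-- The analytic topology on `X(F)`: the coarsest one for which `V(F)` is open for every Zariski
open `V`, and every regular function on `V` is continuous on `V(F)`. -/
instance RatPoint.instTopologicalSpace (π : X ⟶ Spec (CommRingCat.of F)) :
    TopologicalSpace (RatPoint π) :=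
  TopologicalSpace.generateFrom
    {S | ∃ (V : X.Opens) (f : Γ(X, V)) (W : Set F), IsOpen W ∧
      S = {x | x.MemOpen V ∧ regVal π V f x ∈ W}}

instance RatPoint.instMeasurableSpace (π : X ⟶ Spec (CommRingCat.of F)) :
    MeasurableSpace (RatPoint π) :=
  borel (RatPoint π)

instance RatPoint.instBorelSpace (π : X ⟶ Spec (CommRingCat.of F)) :
    BorelSpace (RatPoint π) :=
  ⟨rfl⟩

/-- The `F`-analytic charts of `X(F)` with values in `F ^ n`: homeomorphisms `ψ` from an open
subset of `X(F)` onto an open subset of `F ^ n` which are analytic in both directions. That is,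
regular functions on Zariski open sets are analytic in the coordinates given by `ψ`, and locally
`ψ` is an analytic function of finitely many regular functions. -/
def analyticCharts (π : X ⟶ Spec (CommRingCat.of F)) (n : ℕ) :
    Set (OpenPartialHomeomorph (RatPoint π) (Fin n → F)) :=
  {ψ | (∀ (V : X.Opens) (f : Γ(X, V)), ∀ y ∈ ψ.target, (ψ.symm y).MemOpen V →
          AnalyticAt F (fun z => regVal π V f (ψ.symm z)) y) ∧
       (∀ x ∈ ψ.source, ∃ (V : X.Opens) (N : ℕ) (g : Fin N → Γ(X, V))
          (H : (Fin N → F) → (Fin n → F)),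
          x.MemOpen V ∧ AnalyticAt F H (fun j => regVal π V (g j) x) ∧
          ∀ᶠ x' in 𝓝 x, ψ x' = H (fun j => regVal π V (g j) x'))}

end AnalyticStructure

end AnalyticLct

end

/-! Near any point of `X` there are étale coordinates `τ : F[X₁, …, Xₙ] → Γ(X, V)`. As étale maps
are quasi-finite, every prime of `Γ(X, V)` over `0` is minimal; no minimal prime contains all the
`φ i`, so the ideal generated by the `φ i` contains `τ a` for some polynomial `a ≠ 0`. Writing
`τ a = ∑ i, c i * φ i`, the ultrametric inequality bounds `min_i |φ i| ^ (-s)` on a compact set by a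
constant multiple of `|τ a| ^ (-s)`. Realizing `V` inside affine space as a zero locus with
invertible Jacobian, the inverse function theorem shows that `τ` gives analytic charts of `V(F)`, so
everything reduces to the local integrability of `|a| ^ (-s)` on `F ^ n` for small `s > 0`.

For a monic polynomial `Q` of degree `d` in one variable, Lagrange interpolation of the leading
coefficient shows that `{|Q| < η ^ d}` has no `d + 1` points at mutual distances `> η`, hence is
covered by `d` balls of radius `η`; integrating over level sets bounds `∫ |Q| ^ (-s)` uniformly
in `Q`. Several variables follow by Fubini, the leading coefficient being a nonzero polynomial in
the remaining variables. The exponent depends only on `a`, hence only on `V`, and finitely many `V`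
cover `X`. -/

noncomputable section

namespace AnalyticLct

section SublevelSets

theorem encard_le_natDegree_of_isSeparated {F : Type*} [NormedField F] [IsUltrametricDist F]
    {Q : Polynomial F} (hQ : Q.Monic) {η : ℝ≥0} {T : Set F} (hT : Metric.IsSeparated η T)
    (hTQ : ∀ x ∈ T, ‖Q.eval x‖ < η ^ Q.natDegree) : T.encard ≤ Q.natDegree := by
  classical
  by_contra! hcard
  obtain ⟨t, htT, ht⟩ := Set.exists_subset_encard_eq (Order.add_one_le_of_lt hcard)
  obtain ⟨t, rfl⟩ := (Set.finite_of_encard_eq_coe (k := Q.natDegree + 1) ht).exists_finset_coe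
  replace ht : t.card = Q.natDegree + 1 := by
    rw [Set.encard_coe_eq_coe_finsetCard] at ht
    exact_mod_cast ht
  have hlagrange : 1 = ∑ x ∈ t, Q.eval x / ∏ y ∈ t.erase x, (x - y) := by
    rw [← hQ.leadingCoeff]
    exact Lagrange.leadingCoeff_eq_sum (Set.injOn_id _)
      (by rw [ht, Polynomial.degree_eq_natDegree hQ.ne_zero]; norm_cast)
  have hne : t.Nonempty := Finset.card_pos.1 (by omega)
  obtain ⟨x, hx, hle⟩ := IsUltrametricDist.exists_norm_finsetSum_le_of_nonempty hne
    fun x => Q.eval x / ∏ y ∈ t.erase x, (x - y)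
  have hprod : (η : ℝ) ^ Q.natDegree ≤ ∏ y ∈ t.erase x, ‖x - y‖ := by
    have hcard : (t.erase x).card = Q.natDegree := by
      rw [Finset.card_erase_of_mem hx, ht, Nat.add_sub_cancel]
    rw [← hcard, ← Finset.prod_const]
    refine Finset.prod_le_prod (fun _ _ => η.2) fun y hy => ?_
    have hxy : (η : ℝ≥0∞) < edist x y :=
      hT (htT hx) (htT (Finset.mem_of_mem_erase hy)) (Finset.ne_of_mem_erase hy).symm
    rw [edist_nndist, ENNReal.coe_lt_coe] at hxy
    rw [← dist_eq_norm]
    exact_mod_cast hxy.le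
  have hlt := (hTQ x (htT hx)).trans_le hprod
  rw [← hlagrange, norm_one, norm_div, norm_prod,
    one_le_div ((norm_nonneg _).trans_lt hlt)] at hle
  exact hle.not_gt hlt

variable {F : Type*} [MeasurableSpace F]

theorem measure_le_mul_measure_closedBall_of_packingNumber_le [NormedAddCommGroup F] [BorelSpace F]
    (μ : Measure F) [μ.IsAddHaarMeasure] {S : Set F} {η : ℝ≥0} {d : ℕ}
    (h : Metric.packingNumber η S ≤ d) : μ S ≤ d * μ (Metric.closedBall 0 η) := by
  have hcov : Metric.coveringNumber η S ≤ d := (Metric.coveringNumber_le_packingNumber η S).trans h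
  obtain ⟨T, -, hT, hST, hTcard⟩ := Metric.exists_set_encard_eq_coveringNumber
    (hcov.trans_lt (ENat.natCast_lt_top d)).ne
  rw [← hTcard, hT.encard_eq_coe_toFinset_card, Nat.cast_le] at hcov
  calc μ S ≤ μ (⋃ x ∈ hT.toFinset, Metric.closedBall x η) := by
        refine measure_mono ?_
        simpa using Metric.isCover_iff_subset_iUnion_closedBall.1 hST
    _ ≤ ∑ x ∈ hT.toFinset, μ (Metric.closedBall x η) := measure_biUnion_finset_le _ _
    _ = hT.toFinset.card * μ (Metric.closedBall 0 η) := by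
        simp only [Measure.addHaar_closedBall_center, Finset.sum_const, nsmul_eq_mul]
    _ ≤ d * μ (Metric.closedBall 0 η) := by gcongr

theorem two_mul_measure_closedBall_le [NormedAddCommGroup F] [IsUltrametricDist F] [BorelSpace F]
    (μ : Measure F) [μ.IsAddHaarMeasure] {r : ℝ} {y : F} (hr : r < ‖y‖) :
    2 * μ (Metric.closedBall 0 r) ≤ μ (Metric.closedBall 0 ‖y‖) := by
  have hdisj : Disjoint (Metric.closedBall 0 r) (Metric.closedBall y r) :=
    Set.disjoint_left.2 fun z hz0 hzy => hr.not_ge <| calc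
      ‖y‖ = dist y 0 := (dist_zero_right y).symm
      _ ≤ max (dist y z) (dist z 0) := dist_triangle_max y z 0
      _ ≤ r := max_le (Metric.mem_closedBall'.1 hzy) hz0
  calc 2 * μ (Metric.closedBall 0 r)
      = μ (Metric.closedBall 0 r ∪ Metric.closedBall y r) := by
        rw [measure_union hdisj Metric.isClosed_closedBall.measurableSet,
          Measure.addHaar_closedBall_center μ y, two_mul]
    _ ≤ μ (Metric.closedBall 0 ‖y‖) := by
        refine measure_mono (Set.union_subset (Metric.closedBall_subset_closedBall hr.le) ?_)
        rw [IsUltrametricDist.closedBall_eq_of_mem (x := 0) (y := y) (by simp)]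
        exact Metric.closedBall_subset_closedBall hr.le

theorem two_pow_mul_measure_closedBall_le [NormedField F] [IsUltrametricDist F] [BorelSpace F]
    (μ : Measure F) [μ.IsAddHaarMeasure] {w : F} (hw0 : 0 < ‖w‖) (hw1 : ‖w‖ < 1) (k : ℕ) :
    2 ^ k * μ (Metric.closedBall 0 (‖w‖ ^ k)) ≤ μ (Metric.closedBall 0 1) := by
  induction k with
  | zero => simp
  | succ k ih =>
    refine le_trans ?_ ih
    rw [pow_succ, mul_assoc, ← norm_pow w k]
    gcongr
    refine two_mul_measure_closedBall_le μ ?_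
    rw [norm_pow]
    exact pow_lt_pow_right_of_lt_one₀ hw0 hw1 k.lt_succ_self

theorem two_pow_mul_measure_norm_eval_lt_le [NormedField F] [IsUltrametricDist F] [BorelSpace F]
    (μ : Measure F) [μ.IsAddHaarMeasure] {w : F} (hw0 : 0 < ‖w‖) (hw1 : ‖w‖ < 1)
    {Q : Polynomial F} (hQ : Q.Monic) (k : ℕ) :
    2 ^ k * μ {x | ‖Q.eval x‖ < (‖w‖ ^ k) ^ Q.natDegree} ≤
      Q.natDegree * μ (Metric.closedBall 0 1) := by
  have hpack : Metric.packingNumber (‖w‖₊ ^ k) {x | ‖Q.eval x‖ < (‖w‖ ^ k) ^ Q.natDegree} ≤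
      Q.natDegree :=
    iSup₂_le fun T hT => iSup_le fun hsep => encard_le_natDegree_of_isSeparated hQ hsep hT
  calc _ ≤ 2 ^ k * (Q.natDegree * μ (Metric.closedBall 0 (‖w‖ ^ k))) := by
        gcongr
        exact_mod_cast measure_le_mul_measure_closedBall_of_packingNumber_le μ hpack
    _ = Q.natDegree * (2 ^ k * μ (Metric.closedBall 0 (‖w‖ ^ k))) := mul_left_comm _ _ _
    _ ≤ _ := by gcongr; exact two_pow_mul_measure_closedBall_le μ hw0 hw1 k

end SublevelSets

section LayerCake

theorem rpow_neg_le_one_add_tsum_indicator {θ : ℝ≥0} (hθ1 : θ < 1) {s : ℝ}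
    (hs : 0 < s) (t : ℝ≥0∞) :
    t ^ (-s) ≤
      1 + ∑' k : ℕ, ((θ : ℝ≥0∞) ^ (-s)) ^ (k + 1) * (Set.Iio ((θ : ℝ≥0∞) ^ k)).indicator 1 t := by
  classical
  have hb : 1 ≤ (θ : ℝ≥0∞) ^ (-s) := by
    rw [ENNReal.rpow_neg, ENNReal.one_le_inv]
    exact ENNReal.rpow_le_one (by exact_mod_cast hθ1.le) hs.le
  by_cases ht : ∃ k : ℕ, (θ : ℝ≥0∞) ^ k ≤ t
  · rcases hk : Nat.find ht with _ | k
    · refine le_add_right ?_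
      rw [ENNReal.rpow_neg, ENNReal.inv_le_one]
      exact ENNReal.one_le_rpow (by simpa [hk] using Nat.find_spec ht) hs
    · have hlt : t < (θ : ℝ≥0∞) ^ k := not_le.1 (Nat.find_min ht (hk ▸ k.lt_succ_self))
      calc t ^ (-s) ≤ ((θ : ℝ≥0∞) ^ (k + 1)) ^ (-s) := by
            rw [ENNReal.rpow_neg, ENNReal.rpow_neg, ENNReal.inv_le_inv]
            exact ENNReal.rpow_le_rpow (hk ▸ Nat.find_spec ht) hs.le
        _ = ((θ : ℝ≥0∞) ^ (-s)) ^ (k + 1) * (Set.Iio ((θ : ℝ≥0∞) ^ k)).indicator 1 t := by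
            rw [Set.indicator_of_mem (Set.mem_Iio.2 hlt), Pi.one_apply, mul_one,
              ← ENNReal.rpow_natCast, ← ENNReal.rpow_natCast, ← ENNReal.rpow_mul,
              ← ENNReal.rpow_mul, mul_comm]
        _ ≤ _ := le_add_left (ENNReal.le_tsum k)
  · push Not at ht
    have hsum : ∑' _ : ℕ, (1 : ℝ≥0∞) ≤
        ∑' k : ℕ, ((θ : ℝ≥0∞) ^ (-s)) ^ (k + 1) * (Set.Iio ((θ : ℝ≥0∞) ^ k)).indicator 1 t :=
      ENNReal.tsum_le_tsum fun k => by
        rw [Set.indicator_of_mem (Set.mem_Iio.2 (ht k)), Pi.one_apply, mul_one]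
        exact one_le_pow₀ hb
    refine le_add_left (le_trans ?_ hsum)
    simp

theorem lintegral_rpow_neg_le_add_tsum {α : Type*} [MeasurableSpace α] (μ : Measure α)
    {f : α → ℝ≥0∞} (hf : Measurable f) {θ : ℝ≥0} (hθ1 : θ < 1) {s : ℝ}
    (hs : 0 < s) :
    ∫⁻ x, f x ^ (-s) ∂μ ≤
      μ Set.univ + ∑' k : ℕ, ((θ : ℝ≥0∞) ^ (-s)) ^ (k + 1) * μ {x | f x < (θ : ℝ≥0∞) ^ k} := by
  have hmeas (k : ℕ) :
      Measurable fun x => (Set.Iio ((θ : ℝ≥0∞) ^ k)).indicator (1 : ℝ≥0∞ → ℝ≥0∞) (f x) :=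
    (measurable_one.indicator measurableSet_Iio).comp hf
  calc ∫⁻ x, f x ^ (-s) ∂μ
      ≤ ∫⁻ x, 1 + ∑' k : ℕ, ((θ : ℝ≥0∞) ^ (-s)) ^ (k + 1) *
          (Set.Iio ((θ : ℝ≥0∞) ^ k)).indicator 1 (f x) ∂μ :=
        lintegral_mono fun x => rpow_neg_le_one_add_tsum_indicator hθ1 hs (f x)
    _ = μ Set.univ + ∑' k : ℕ, ((θ : ℝ≥0∞) ^ (-s)) ^ (k + 1) *
          ∫⁻ x, (Set.Iio ((θ : ℝ≥0∞) ^ k)).indicator 1 (f x) ∂μ := by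
        rw [lintegral_add_left measurable_const, lintegral_one,
          lintegral_tsum fun k => ((hmeas k).const_mul _).aemeasurable]
        simp_rw [lintegral_const_mul _ (hmeas _)]
    _ = _ := by
        congr! 4 with k
        exact lintegral_indicator_one (hf measurableSet_Iio)

theorem eventually_rpow_neg_lt_two {θ : ℝ≥0} (hθ : θ ≠ 0) :
    ∀ᶠ s : ℝ≥0 in 𝓝[>] 0, (θ : ℝ≥0∞) ^ (-(s : ℝ)) < 2 := by
  have hcont : Continuous fun s : ℝ≥0 => (θ : ℝ) ^ (-(s : ℝ)) :=
    (Real.continuous_const_rpow (by exact_mod_cast hθ)).comp (by fun_prop)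
  have hlt : ∀ᶠ s : ℝ≥0 in 𝓝 0, (θ : ℝ) ^ (-(s : ℝ)) < 2 :=
    (hcont.tendsto 0).eventually_lt_const (by simp)
  filter_upwards [hlt.filter_mono nhdsWithin_le_nhds] with s hs
  rw [← ENNReal.coe_rpow_of_ne_zero hθ]
  exact_mod_cast hs

theorem eventually_lintegral_rpow_neg_le_of_two_pow_mul_measure_le {θ : ℝ≥0} (hθ0 : θ ≠ 0)
    (hθ1 : θ < 1) {α : Type*} [MeasurableSpace α] :
    ∀ᶠ s : ℝ≥0 in 𝓝[>] 0, ∃ C : ℝ≥0, ∀ (μ : Measure α) (f : α → ℝ≥0∞) (m : ℝ≥0∞),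
      Measurable f → (∀ k : ℕ, 2 ^ k * μ {x | f x < (θ : ℝ≥0∞) ^ k} ≤ m) →
        ∫⁻ x, f x ^ (-(s : ℝ)) ∂μ ≤ μ Set.univ + C * m := by
  filter_upwards [eventually_rpow_neg_lt_two hθ0, self_mem_nhdsWithin] with s hs2 hs0
  set b : ℝ≥0∞ := (θ : ℝ≥0∞) ^ (-(s : ℝ))
  have hfin : b * (1 - b / 2)⁻¹ ≠ ∞ := by
    refine ENNReal.mul_ne_top (hs2.trans ENNReal.ofNat_lt_top).ne (ENNReal.inv_ne_top.2 ?_)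
    refine (tsub_pos_of_lt ?_).ne'
    rwa [ENNReal.div_lt_iff (by simp) (by simp), one_mul]
  refine ⟨(b * (1 - b / 2)⁻¹).toNNReal, fun μ f m hf hm => ?_⟩
  rw [ENNReal.coe_toNNReal hfin]
  calc ∫⁻ x, f x ^ (-(s : ℝ)) ∂μ
      ≤ μ Set.univ + ∑' k : ℕ, b ^ (k + 1) * μ {x | f x < (θ : ℝ≥0∞) ^ k} :=
        lintegral_rpow_neg_le_add_tsum μ hf hθ1 (by exact_mod_cast hs0)
    _ ≤ μ Set.univ + ∑' k : ℕ, b ^ (k + 1) * (m / 2 ^ k) := by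
        gcongr with k
        rw [ENNReal.le_div_iff_mul_le (by simp) (by simp), mul_comm]
        exact hm k
    _ = μ Set.univ + ∑' k : ℕ, b * m * (b / 2) ^ k := by
        simp_rw [div_eq_mul_inv, mul_pow, ENNReal.inv_pow, pow_succ]
        congr! 3 with k
        ring
    _ = μ Set.univ + b * (1 - b / 2)⁻¹ * m := by
        rw [ENNReal.tsum_mul_left, ENNReal.tsum_geometric, mul_right_comm]

end LayerCake

section OneVariable

variable {F : Type*} [NontriviallyNormedField F] [MeasurableSpace F] [BorelSpace F]
  [IsUltrametricDist F] [ProperSpace F] (μ : Measure F) [μ.IsAddHaarMeasure]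

theorem eventually_setLIntegral_monic_rpow_neg_le (d : ℕ) :
    ∀ᶠ s : ℝ≥0 in 𝓝[>] 0, ∃ C : ℝ≥0, ∀ (K : Set F) (Q : Polynomial F),
      Q.Monic → Q.natDegree ≤ d → ∫⁻ x in K, ‖Q.eval x‖ₑ ^ (-(s : ℝ)) ∂μ ≤ μ K + C := by
  obtain ⟨w, hw0, hw1⟩ := NormedField.exists_norm_lt_one F
  have hθ0 : ‖w‖₊ ^ (d + 1) ≠ 0 := pow_ne_zero _ (nnnorm_ne_zero_iff.2 (norm_pos_iff.1 hw0))
  have hθ1 : ‖w‖₊ ^ (d + 1) < 1 := by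
    exact_mod_cast pow_lt_one₀ hw0.le hw1 d.succ_ne_zero
  have hball : μ (Metric.closedBall 0 1) ≠ ∞ := (isCompact_closedBall 0 1).measure_ne_top
  filter_upwards [eventually_lintegral_rpow_neg_le_of_two_pow_mul_measure_le (α := F) hθ0 hθ1]
    with s ⟨C, hC⟩
  refine ⟨C * (d * (μ (Metric.closedBall 0 1)).toNNReal), fun K Q hQ hQd => ?_⟩
  have hsub (k : ℕ) : {x | ‖Q.eval x‖ₑ < ((‖w‖₊ ^ (d + 1) : ℝ≥0) : ℝ≥0∞) ^ k} ⊆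
      {x | ‖Q.eval x‖ < (‖w‖ ^ k) ^ Q.natDegree} := fun x hx => by
    have hx' : ‖Q.eval x‖ < (‖w‖ ^ (d + 1)) ^ k := by
      rw [Set.mem_ofPred_eq, enorm_eq_nnnorm] at hx
      exact_mod_cast hx
    refine hx'.trans_le ?_
    rw [← pow_mul, ← pow_mul, mul_comm (d + 1)]
    exact pow_le_pow_of_le_one hw0.le hw1.le (by gcongr; omega)
  have hmeas : Measurable fun x => ‖Q.eval x‖ₑ := Q.continuous.measurable.enorm
  refine (hC (μ.restrict K) _ (d * μ (Metric.closedBall 0 1)) hmeas fun k => ?_).trans_eq ?_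
  · calc _ ≤ 2 ^ k * μ {x | ‖Q.eval x‖ < (‖w‖ ^ k) ^ Q.natDegree} := by
          gcongr 2 ^ k * ?_
          exact (Measure.restrict_apply_le _ _).trans (measure_mono (hsub k))
      _ ≤ Q.natDegree * μ (Metric.closedBall 0 1) :=
          two_pow_mul_measure_norm_eval_lt_le μ hw0 hw1 hQ k
      _ ≤ d * μ (Metric.closedBall 0 1) := by gcongr
  · rw [Measure.restrict_apply_univ, ENNReal.coe_mul, ENNReal.coe_mul, ENNReal.coe_natCast,
      ENNReal.coe_toNNReal hball]

theorem eventually_setLIntegral_polynomial_rpow_neg_le (d : ℕ) :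
    ∀ᶠ s : ℝ≥0 in 𝓝[>] 0, ∃ C : ℝ≥0, ∀ (K : Set F) (P : Polynomial F), P.natDegree ≤ d →
      ∫⁻ x in K, ‖P.eval x‖ₑ ^ (-(s : ℝ)) ∂μ ≤ (μ K + C) * ‖P.coeff d‖ₑ ^ (-(s : ℝ)) := by
  filter_upwards [eventually_setLIntegral_monic_rpow_neg_le μ d, self_mem_nhdsWithin]
    with s ⟨C, hC⟩ hs
  refine ⟨C, fun K P hP => ?_⟩
  rcases eq_or_ne (μ K) 0 with hK | hK
  · simp [Measure.restrict_eq_zero.2 hK]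
  rcases eq_or_ne (P.coeff d) 0 with hc | hc
  · rw [hc, enorm_zero, ENNReal.zero_rpow_of_neg (by simpa using hs),
      ENNReal.mul_top (by simp [hK])]
    exact le_top
  have hdeg : P.natDegree = d := hP.antisymm (Polynomial.le_natDegree_of_ne_zero hc)
  set c := P.coeff d
  have hQ : (Polynomial.C c⁻¹ * P).Monic :=
    Polynomial.monic_C_mul_of_mul_leadingCoeff_eq_one (by
      rw [Polynomial.leadingCoeff, hdeg, inv_mul_cancel₀ hc])
  calc ∫⁻ x in K, ‖P.eval x‖ₑ ^ (-(s : ℝ)) ∂μ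
      = ∫⁻ x in K, ‖c‖ₑ ^ (-(s : ℝ)) * ‖(Polynomial.C c⁻¹ * P).eval x‖ₑ ^ (-(s : ℝ)) ∂μ := by
        congr! 2 with x
        rw [← ENNReal.mul_rpow_of_ne_top enorm_ne_top enorm_ne_top, ← enorm_mul,
          Polynomial.eval_mul, Polynomial.eval_C, mul_inv_cancel_left₀ hc]
    _ = ‖c‖ₑ ^ (-(s : ℝ)) * ∫⁻ x in K, ‖(Polynomial.C c⁻¹ * P).eval x‖ₑ ^ (-(s : ℝ)) ∂μ :=
        lintegral_const_mul _ ((Polynomial.continuous _).measurable.enorm.pow_const _)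
    _ ≤ ‖c‖ₑ ^ (-(s : ℝ)) * (μ K + C) := by
        gcongr
        exact hC K _ hQ ((Polynomial.natDegree_C_mul_le _ _).trans hP)
    _ = _ := mul_comm _ _

end OneVariable

section SeveralVariables

theorem setLIntegral_pi_succ {F : Type*} [MeasurableSpace F] (μ : Measure F) [SigmaFinite μ]
    {n : ℕ} (K : Set F) {f : (Fin (n + 1) → F) → ℝ≥0∞} (hf : Measurable f) :
    ∫⁻ y in Set.pi Set.univ (fun _ => K), f y ∂(Measure.pi fun _ : Fin (n + 1) => μ) =
      ∫⁻ y in Set.pi Set.univ (fun _ => K), ∫⁻ x in K, f (Fin.cons x y) ∂μ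
        ∂(Measure.pi fun _ : Fin n => μ) := by
  have hmp := (measurePreserving_piFinSuccAbove (fun _ : Fin (n + 1) => μ) 0).symm
  have hset : (MeasurableEquiv.piFinSuccAbove (fun _ : Fin (n + 1) => F) 0).symm ⁻¹'
      (Set.pi Set.univ (fun _ => K)) = K ×ˢ (Set.pi Set.univ (fun _ : Fin n => K)) := by
    ext ⟨x, y⟩
    simp [MeasurableEquiv.piFinSuccAbove, Fin.forall_fin_succ]
  rw [← hmp.setLIntegral_comp_preimage_emb (MeasurableEquiv.measurableEmbedding _), hset,
    ← Measure.prod_restrict, lintegral_prod_symm]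
  · simp [MeasurableEquiv.piFinSuccAbove, Fin.consEquiv]
  · exact (hf.comp (MeasurableEquiv.measurable _)).aemeasurable

variable {F : Type*} [NontriviallyNormedField F] [MeasurableSpace F] [BorelSpace F]
  [ProperSpace F]

theorem measurable_enorm_eval_rpow {n : ℕ} (p : MvPolynomial (Fin n) F) (s : ℝ) :
    Measurable fun y : Fin n → F => ‖MvPolynomial.eval y p‖ₑ ^ s :=
  (MvPolynomial.continuous_eval p).measurable.enorm.pow_const s

theorem eventually_setLIntegral_pi_eval_rpow_neg_lt_top [IsUltrametricDist F] (μ : Measure F)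
    [μ.IsAddHaarMeasure] (n : ℕ) {p : MvPolynomial (Fin n) F} (hp : p ≠ 0) :
    ∀ᶠ s : ℝ≥0 in 𝓝[>] 0, ∀ K : Set F, μ K ≠ ∞ →
      ∫⁻ y in Set.pi Set.univ (fun _ => K), ‖MvPolynomial.eval y p‖ₑ ^ (-(s : ℝ))
        ∂(Measure.pi fun _ : Fin n => μ) < ∞ := by
  induction n with
  | zero =>
    obtain ⟨c, rfl⟩ := MvPolynomial.C_surjective (Fin 0) p
    refine Filter.Eventually.of_forall fun s K _ => ?_
    simp only [MvPolynomial.eval_C, lintegral_const]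
    refine ENNReal.mul_lt_top (lt_top_iff_ne_top.2 ?_) (by simp)
    have hc : c ≠ 0 := by simpa using hp
    simp [ENNReal.rpow_eq_top_iff, hc]
  | succ n ih =>
    set P := MvPolynomial.finSuccEquiv F n p with hP
    have hlead : P.leadingCoeff ≠ 0 := by simpa [hP] using hp
    filter_upwards [ih hlead, eventually_setLIntegral_polynomial_rpow_neg_le μ P.natDegree]
      with s hs ⟨C, hC⟩ K hK
    calc _ = ∫⁻ y in Set.pi Set.univ (fun _ => K), ∫⁻ x in K,
            ‖(P.map (MvPolynomial.eval y)).eval x‖ₑ ^ (-(s : ℝ)) ∂μ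
              ∂(Measure.pi fun _ : Fin n => μ) := by
          simp_rw [setLIntegral_pi_succ μ K (measurable_enorm_eval_rpow p _),
            MvPolynomial.eval_eq_eval_mv_eval', ← hP]
      _ ≤ ∫⁻ y in Set.pi Set.univ (fun _ => K), (μ K + C) *
            ‖MvPolynomial.eval y P.leadingCoeff‖ₑ ^ (-(s : ℝ))
              ∂(Measure.pi fun _ : Fin n => μ) := by
          refine lintegral_mono fun y => ?_
          simpa using hC K (P.map (MvPolynomial.eval y)) Polynomial.natDegree_map_le
      _ = (μ K + C) * ∫⁻ y in Set.pi Set.univ (fun _ => K),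
            ‖MvPolynomial.eval y P.leadingCoeff‖ₑ ^ (-(s : ℝ))
              ∂(Measure.pi fun _ : Fin n => μ) :=
          lintegral_const_mul _ (measurable_enorm_eval_rpow _ _)
      _ < ∞ := ENNReal.mul_lt_top (ENNReal.add_lt_top.2 ⟨hK.lt_top, ENNReal.coe_lt_top⟩) (hs K hK)

theorem eventually_setLIntegral_haar_eval_rpow_neg_lt_top {F : Type u} [NontriviallyNormedField F]
    [IsUltrametricDist F] [LocallyCompactSpace F] [MeasurableSpace F] [BorelSpace F]
    {n : ℕ} {p : MvPolynomial (Fin n) F} (hp : p ≠ 0) :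
    ∀ᶠ s : ℝ≥0 in 𝓝[>] 0, ∀ L : Set (Fin n → F), IsCompact L →
      ∫⁻ y in L, ‖MvPolynomial.eval y p‖ₑ ^ (-(s : ℝ)) ∂(haar F n) < ∞ := by
  have : ProperSpace F := ProperSpace.of_locallyCompactSpace F
  have : (haar F n).IsAddHaarMeasure := by unfold haar; infer_instance
  let μ : Measure F := Measure.addHaar
  filter_upwards [eventually_setLIntegral_pi_eval_rpow_neg_lt_top μ n hp] with s hs L hL
  obtain ⟨R, hR⟩ := hL.isBounded.subset_closedBall 0
  have hsub : L ⊆ Set.pi Set.univ (fun _ => Metric.closedBall (0 : F) (max R 0)) := by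
    refine hR.trans ((Metric.closedBall_subset_closedBall (le_max_left R 0)).trans ?_)
    rw [closedBall_pi _ (le_max_right R 0)]
    rfl
  rw [Measure.isAddLeftInvariant_eq_smul (haar F n) (Measure.pi fun _ : Fin n => μ),
    Measure.restrict_smul, lintegral_smul_measure]
  exact ENNReal.mul_lt_top (by simp) ((lintegral_mono_set hsub).trans_lt
    (hs _ (isCompact_closedBall _ _).measure_ne_top))

end SeveralVariables

section Etale

theorem exists_ne_zero_algebraMap_mem {A B : Type*} [CommRing A] [IsDomain A] [CommRing B]
    [Algebra A B] [Algebra.QuasiFinite A B] (I : Ideal B)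
    (hI : ∀ Q ∈ minimalPrimes B, ¬ I ≤ Q) : ∃ a : A, a ≠ 0 ∧ algebraMap A B a ∈ I := by
  by_contra! hcon
  have hdisj : Disjoint (I : Set B) (Algebra.algebraMapSubmonoid B (nonZeroDivisors A)) := by
    rw [Set.disjoint_left]
    rintro _ hb ⟨a, ha, rfl⟩
    exact hcon a (nonZeroDivisors.ne_zero ha) hb
  obtain ⟨Q, hQ, hIQ, hQd⟩ := Ideal.exists_le_prime_disjoint I _ hdisj
  have hunder : Q.under A = ⊥ := by
    rw [eq_bot_iff]
    intro a ha
    by_contra ha0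
    exact Set.disjoint_left.1 hQd ha ⟨a, mem_nonZeroDivisors_of_ne_zero ha0, rfl⟩
  obtain ⟨Q', hQ', hle⟩ := Ideal.exists_minimalPrimes_le (I := (⊥ : Ideal B)) (J := Q) bot_le
  have : Q'.IsPrime := hQ'.1.1
  have hunder' : Q'.under A = ⊥ := by
    rw [eq_bot_iff, ← hunder]; exact Ideal.comap_mono hle
  have heq := Algebra.QuasiFinite.eq_of_le_of_under_eq (R := A) Q' Q hle (hunder'.trans hunder.symm)
  exact hI Q (heq ▸ hQ') hIQ

theorem exists_submersivePresentation_map_eq_id (A B : Type*) [CommRing A] [CommRing B]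
    [Algebra A B] [Algebra.Etale A B] :
    ∃ (σ : Type) (_ : Finite σ) (P : Algebra.SubmersivePresentation A B σ σ), P.map = id := by
  obtain ⟨ι, σ, _, _, P, hP⟩ := Algebra.Etale.iff_isStandardSmoothOfRelativeDimension_zero.1
    ‹Algebra.Etale A B›
  have hcard : Nat.card ι ≤ Nat.card σ := Nat.sub_eq_zero_iff_le.1 hP
  have hbij : Function.Bijective P.map :=
    (Nat.bijective_iff_injective_and_card _).2 ⟨P.map_inj, le_antisymm
      (Nat.card_le_card_of_injective _ P.map_inj) hcard⟩
  refine ⟨σ, inferInstance, P.reindex (Equiv.ofBijective _ hbij) (Equiv.refl _), ?_⟩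
  ext j
  simp [Algebra.SubmersivePresentation.reindex, Algebra.PreSubmersivePresentation.reindex]

theorem exists_surjective_ker_eq_span_isUnit_jacobian {ι R B : Type*} [CommRing R] [CommRing B]
    {τ : MvPolynomial ι R →+* B} (hτ : τ.Etale) :
    ∃ (σ : Type) (_ : Fintype σ) (_ : DecidableEq σ) (g : σ → MvPolynomial (σ ⊕ ι) R)
      (θ : MvPolynomial (σ ⊕ ι) R →+* B), Function.Surjective θ ∧
        θ.comp (MvPolynomial.rename Sum.inr).toRingHom = τ ∧
        RingHom.ker θ = Ideal.span (Set.range g) ∧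
        IsUnit (θ (Matrix.of fun j i => MvPolynomial.pderiv (Sum.inl i) (g j)).det) := by
  classical
  let := τ.toAlgebra
  have : Algebra.Etale (MvPolynomial ι R) B := hτ
  obtain ⟨σ, _, P, hP⟩ := exists_submersivePresentation_map_eq_id (MvPolynomial ι R) B
  have := Fintype.ofFinite σ
  let e := MvPolynomial.sumAlgEquiv R σ ι
  let θ : MvPolynomial (σ ⊕ ι) R →+* B :=
    (MvPolynomial.aeval P.val : MvPolynomial σ (MvPolynomial ι R) →ₐ[_] B).toRingHom.comp
      e.toRingEquiv.toRingHom
  have hθ (p : MvPolynomial (σ ⊕ ι) R) : θ p = MvPolynomial.aeval P.val (e p) := rfl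
  refine ⟨σ, this, inferInstance, fun j => e.symm (P.relation j), θ, fun b => ?_, ?_, ?_, ?_⟩
  · exact ⟨e.symm (P.σ b), by rw [hθ, e.apply_symm_apply, P.aeval_val_σ]⟩
  · refine MvPolynomial.ringHom_ext (fun r => ?_) fun i => ?_
    · simp [hθ, e, RingHom.algebraMap_toAlgebra]
    · simp [hθ, e, RingHom.algebraMap_toAlgebra]
  · have hker : RingHom.ker θ = (RingHom.ker (MvPolynomial.aeval P.val :
        MvPolynomial σ (MvPolynomial ι R) →ₐ[_] B)).comap e.toRingEquiv := rfl
    rw [hker, ← Algebra.Generators.ker_eq_ker_aeval_val, ← P.span_range_relation_eq_ker,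
      ← Ideal.map_symm e.toRingEquiv, Ideal.map_span, ← Set.range_comp]
    rfl
  · have hunit := P.jacobian_isUnit
    rw [Algebra.PreSubmersivePresentation.jacobian_eq_jacobiMatrix_det, P.algebraMap_eq,
      ← Matrix.det_transpose] at hunit
    convert hunit
    rw [hθ, AlgEquiv.map_det, AlgHom.map_det, RingHom.map_det]
    refine congrArg Matrix.det (Matrix.ext fun j i => ?_)
    simp [e, ← MvPolynomial.pderiv_sumAlgEquiv,
      Algebra.PreSubmersivePresentation.jacobiMatrix_apply, hP]

end Etale

section PolynomialMaps

variable {F ι : Type*} [NontriviallyNormedField F] [Fintype ι]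

theorem analyticAt_eval (p : MvPolynomial ι F) (z : ι → F) :
    AnalyticAt F (fun y => MvPolynomial.eval y p) z :=
  AnalyticAt.aeval_mvPolynomial (f := fun y : ι → F => y)
    (fun i => (ContinuousLinearMap.proj (R := F) (φ := fun _ : ι => F) i).analyticAt z) p

theorem fderiv_eval (p : MvPolynomial ι F) (z v : ι → F) :
    fderiv F (fun y => MvPolynomial.eval y p) z v =
      ∑ i, MvPolynomial.eval z (MvPolynomial.pderiv i p) * v i := by
  classical
  have hd (q : MvPolynomial ι F) : DifferentiableAt F (fun y => MvPolynomial.eval y q) z :=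
    (analyticAt_eval q z).differentiableAt
  induction p using MvPolynomial.induction_on with
  | C c => simp
  | add p q hp hq =>
    simp_rw [map_add, fderiv_fun_add (hd p) (hd q)]
    simp [hp, hq, add_mul, Finset.sum_add_distrib]
  | mul_X p i hp =>
    have hX : fderiv F (fun y : ι → F => y i) z v = v i :=
      congr($((ContinuousLinearMap.proj (R := F) (φ := fun _ : ι => F) i).fderiv (x := z)) v)
    simp_rw [map_mul, MvPolynomial.eval_X]
    rw [fderiv_fun_mul (hd p) (by fun_prop)]
    simp [hp, hX, MvPolynomial.pderiv_X, Pi.single_apply, add_mul, Finset.sum_add_distrib,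
      apply_ite, Finset.mul_sum, mul_assoc]

variable (G : ι → MvPolynomial ι F)

/-- The Jacobian matrix at `z` of the polynomial map with components `G`, the matrix of its
derivative in the inverse function theorem. Rows are indexed by components, columns by variables. -/
def jacobianMatrix (z : ι → F) : Matrix ι ι F :=
  Matrix.of fun k i => MvPolynomial.eval z (MvPolynomial.pderiv i (G k))

theorem hasStrictFDerivAt_eval [CompleteSpace F] [DecidableEq ι] (z : ι → F) :
    HasStrictFDerivAt (fun y k => MvPolynomial.eval y (G k))
      (LinearMap.toContinuousLinearMap (Matrix.toLin' (jacobianMatrix G z))) z := by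
  refine hasStrictFDerivAt_pi'.2 fun k => ?_
  convert (analyticAt_eval (G k) z).hasStrictFDerivAt
  ext1 v
  rw [fderiv_eval]
  rfl

theorem continuous_det_jacobianMatrix [DecidableEq ι] :
    Continuous fun z => (jacobianMatrix G z).det :=
  Continuous.matrix_det (continuous_matrix fun _ _ => MvPolynomial.continuous_eval _)

theorem exists_openPartialHomeomorph_eval [CompleteSpace F] [DecidableEq ι]
    {z₀ : ι → F} (hz₀ : (jacobianMatrix G z₀).det ≠ 0) :
    ∃ Φ : OpenPartialHomeomorph (ι → F) (ι → F), z₀ ∈ Φ.source ∧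
      (∀ z k, Φ z k = MvPolynomial.eval z (G k)) ∧ ∀ y ∈ Φ.target, AnalyticAt F Φ.symm y := by
  have hequiv (z : ι → F) (hz : (jacobianMatrix G z).det ≠ 0) :
      ∃ L : (ι → F) ≃L[F] (ι → F), HasStrictFDerivAt (fun y k => MvPolynomial.eval y (G k))
        (L : (ι → F) →L[F] (ι → F)) z :=
    ⟨ContinuousLinearMap.toContinuousLinearEquivOfDetNeZero
      (LinearMap.toContinuousLinearMap (Matrix.toLin' (jacobianMatrix G z)))
      (by rwa [LinearMap.det_toContinuousLinearMap, LinearMap.det_toLin']),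
      by simpa using hasStrictFDerivAt_eval G z⟩
  obtain ⟨L₀, hL₀⟩ := hequiv z₀ hz₀
  let Φ := (hL₀.toOpenPartialHomeomorph _).restrOpen {z | (jacobianMatrix G z).det ≠ 0}
    (isOpen_ne.preimage (continuous_det_jacobianMatrix G))
  refine ⟨Φ, ⟨hL₀.mem_toOpenPartialHomeomorph_source, hz₀⟩, fun _ _ => rfl, fun y hy => ?_⟩
  obtain ⟨L, hL⟩ := hequiv (Φ.symm y) (Φ.map_target hy).2
  have han : AnalyticAt F (fun y k => MvPolynomial.eval y (G k)) (Φ.symm y) :=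
    AnalyticAt.pi fun k => analyticAt_eval (G k) _
  exact OpenPartialHomeomorph.analyticAt_symm Φ hy han hL.hasFDerivAt.fderiv

theorem exists_openPartialHomeomorph_sumElim_eval [CompleteSpace F] {σ : Type*} [Fintype σ]
    [DecidableEq σ] (g : σ → MvPolynomial (σ ⊕ ι) F) {z₀ : σ ⊕ ι → F}
    (hz₀ : MvPolynomial.eval z₀
      (Matrix.of fun j i => MvPolynomial.pderiv (Sum.inl i) (g j)).det ≠ 0) :
    ∃ Φ : OpenPartialHomeomorph (σ ⊕ ι → F) (σ ⊕ ι → F), z₀ ∈ Φ.source ∧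
      (∀ z, Φ z = Sum.elim (fun j => MvPolynomial.eval z (g j)) (z ∘ Sum.inr)) ∧
      ∀ y ∈ Φ.target, AnalyticAt F Φ.symm y := by
  classical
  let G : σ ⊕ ι → MvPolynomial (σ ⊕ ι) F := Sum.elim g fun i => MvPolynomial.X (Sum.inr i)
  have hblocks : jacobianMatrix G z₀ = Matrix.fromBlocks
      (Matrix.of fun j i => MvPolynomial.eval z₀ (MvPolynomial.pderiv (Sum.inl i) (g j)))
      (Matrix.of fun j i => MvPolynomial.eval z₀ (MvPolynomial.pderiv (Sum.inr i) (g j))) 0 1 := by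
    ext (j | j) (i | i) <;>
      simp [jacobianMatrix, G, MvPolynomial.pderiv_X, Pi.single_apply, Matrix.one_apply, apply_ite]
  have hdet : (jacobianMatrix G z₀).det ≠ 0 := by
    rw [hblocks, Matrix.det_fromBlocks_zero₂₁, Matrix.det_one, mul_one]
    rwa [RingHom.map_det] at hz₀
  obtain ⟨Φ, hmem, hΦ, hanalytic⟩ := exists_openPartialHomeomorph_eval G hdet
  refine ⟨Φ, hmem, fun z => funext ?_, hanalytic⟩
  rintro (j | i) <;> simp [hΦ, G]

end PolynomialMaps

section Points

variable {F : Type u} [Field F] {X : Scheme.{u}} {π : X ⟶ Spec (CommRingCat.of F)}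

/-- The structure homomorphism of the `F`-algebra of regular functions on `V`, against which the
`F`-linearity of ring homomorphisms is stated; no `Algebra` instance is put on `Γ(X, V)`. -/
def structHom (π : X ⟶ Spec (CommRingCat.of F)) (V : X.Opens) : F →+* Γ(X, V) :=
  ((Scheme.ΓSpecIso (CommRingCat.of F)).inv ≫ π.appLE ⊤ V le_top).hom

/-- Evaluation of the regular functions on `V` at a rational point of `V`: the ring homomorphism
underlying `RatPoint.evalOn`, which for affine `V` determines the point. -/
def RatPoint.evalHom (x : RatPoint π) (V : X.Opens) (h : x.MemOpen V) : Γ(X, V) →+* F :=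
  (x.1.appLE V ⊤ h ≫ (Scheme.ΓSpecIso (CommRingCat.of F)).hom).hom

theorem regVal_eq_evalHom (x : RatPoint π) (V : X.Opens) (h : x.MemOpen V) (f : Γ(X, V)) :
    regVal π V f x = x.evalHom V h f := by
  rw [regVal, dif_pos h]; rfl

theorem RatPoint.MemOpen.mono {x : RatPoint π} {V W : X.Opens} (h : x.MemOpen V) (hVW : V ≤ W) :
    x.MemOpen W :=
  le_trans (show ⊤ ≤ x.1 ⁻¹ᵁ V from h) (x.1.preimage_mono hVW)

theorem RatPoint.memOpen_top (x : RatPoint π) : x.MemOpen ⊤ := le_top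

theorem RatPoint.evalHom_map (x : RatPoint π) {V W : X.Opens} (i : V ⟶ W) (h : x.MemOpen V)
    (f : Γ(X, W)) :
    x.evalHom V h (X.presheaf.map i.op f) = x.evalHom W (h.mono i.le) f := by
  have hmap := congr($(x.1.map_appLE (show ⊤ ≤ x.1 ⁻¹ᵁ V from h) i.op) f)
  simp only [CommRingCat.comp_apply] at hmap
  simp only [RatPoint.evalHom, CommRingCat.hom_comp, RingHom.comp_apply, ← hmap]

theorem RatPoint.evalHom_comp_structHom (x : RatPoint π) (V : X.Opens) (h : x.MemOpen V) :
    (x.evalHom V h).comp (structHom π V) = RingHom.id F := by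
  have hid : ∀ (y : Spec (CommRingCat.of F) ⟶ Spec (CommRingCat.of F)) (_ : y = 𝟙 _)
      (e : ⊤ ≤ y ⁻¹ᵁ ⊤), y.appLE ⊤ ⊤ e = 𝟙 _ := by
    rintro _ rfl e
    simp only [Scheme.Hom.appLE, Scheme.Hom.id_app]
    exact (Spec (CommRingCat.of F)).presheaf.map_id _
  have hsection : π.appLE ⊤ V le_top ≫ x.1.appLE V ⊤ h = 𝟙 _ :=
    (Scheme.Hom.appLE_comp_appLE x.1 π ⊤ V ⊤ le_top h).trans (hid _ x.2 _)
  have hglobal : (Scheme.ΓSpecIso (CommRingCat.of F)).inv ≫ π.appLE ⊤ V le_top ≫ x.1.appLE V ⊤ h ≫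
      (Scheme.ΓSpecIso (CommRingCat.of F)).hom = 𝟙 _ := by
    rw [reassoc_of% hsection, Iso.inv_hom_id]
  exact congr($(hglobal).hom)

theorem RatPoint.eq_specMap_evalHom (x : RatPoint π) {V : X.Opens} (hV : IsAffineOpen V)
    (h : x.MemOpen V) :
    x.1 = Spec.map (CommRingCat.ofHom (x.evalHom V h)) ≫ hV.fromSpec := by
  have hfactor := IsAffineOpen.SpecMap_appLE_fromSpec x.1 hV
    (isAffineOpen_top (Spec (CommRingCat.of F))) h
  rw [IsAffineOpen.fromSpec_top, Scheme.isoSpec_Spec_inv] at hfactor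
  have hevalHom : CommRingCat.ofHom (x.evalHom V h) = x.1.appLE V ⊤ h ≫
      (Scheme.ΓSpecIso (CommRingCat.of F)).hom := rfl
  rw [hevalHom, Spec.map_comp, Category.assoc, hfactor, ← Spec.map_comp_assoc, Iso.inv_hom_id,
    Spec.map_id, Category.id_comp]

theorem RatPoint.ext_of_evalHom_eq {x x' : RatPoint π} {V : X.Opens} (hV : IsAffineOpen V)
    (h : x.MemOpen V) (h' : x'.MemOpen V) (heq : x.evalHom V h = x'.evalHom V h') : x = x' := by
  apply Subtype.ext
  rw [x.eq_specMap_evalHom hV h, x'.eq_specMap_evalHom hV h', heq]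

theorem exists_ratPoint_evalHom_eq {V : X.Opens} (hV : IsAffineOpen V) (e : Γ(X, V) →+* F)
    (he : e.comp (structHom π V) = RingHom.id F) :
    ∃ (x : RatPoint π) (h : x.MemOpen V), x.evalHom V h = e := by
  have hcomp : (Spec.map (CommRingCat.ofHom e) ≫ hV.fromSpec) ≫ π = 𝟙 _ := by
    have hfactor := IsAffineOpen.SpecMap_appLE_fromSpec π
      (isAffineOpen_top (Spec (CommRingCat.of F))) hV le_top
    rw [IsAffineOpen.fromSpec_top, Scheme.isoSpec_Spec_inv] at hfactor
    rw [Category.assoc, ← hfactor, ← Spec.map_comp, ← Spec.map_comp, ← Spec.map_id]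
    congr 1
    exact CommRingCat.hom_ext he
  let x : RatPoint π := ⟨_, hcomp⟩
  have hx : x.MemOpen V := by
    intro z _
    change (Spec.map (CommRingCat.ofHom e) ≫ hV.fromSpec) z ∈ V
    rw [Scheme.Hom.comp_apply]
    exact hV.range_fromSpec.le ⟨_, rfl⟩
  refine ⟨x, hx, ?_⟩
  have hSpec : Spec.map (CommRingCat.ofHom e) = Spec.map (CommRingCat.ofHom (x.evalHom V hx)) :=
    (cancel_mono hV.fromSpec).1 (x.eq_specMap_evalHom hV hx)
  exact (congr($(Spec.map_inj.1 hSpec).hom)).symm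

theorem RatPoint.memOpen_iff (x : RatPoint π) (V : X.Opens)
    (z : Spec (CommRingCat.of F)) : x.MemOpen V ↔ x.1 z ∈ V := by
  refine ⟨fun h => h (x := z) trivial, fun h y _ => ?_⟩
  rwa [show y = z from Subsingleton.elim (α := PrimeSpectrum F) y z]

theorem RatPoint.memOpen_basicOpen (x : RatPoint π) {V : X.Opens} (h : x.MemOpen V) (b : Γ(X, V)) :
    x.MemOpen (X.basicOpen b) ↔ x.evalHom V h b ≠ 0 := by
  constructor
  · intro hb
    have hunit : IsUnit (X.presheaf.map (homOfLE (X.basicOpen_le b)).op b) :=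
      RingedSpace.isUnit_res_basicOpen _ b
    exact (x.evalHom_map _ hb b ▸ hunit.map (x.evalHom _ hb)).ne_zero
  · intro hb
    have hunit : IsUnit (x.1.appLE V ⊤ h b) := by
      have hvalue : IsUnit ((Scheme.ΓSpecIso (CommRingCat.of F)).hom (x.1.appLE V ⊤ h b)) :=
        IsUnit.mk0 _ hb
      simpa using hvalue.map (Scheme.ΓSpecIso (CommRingCat.of F)).inv.hom
    have htop : (Spec (CommRingCat.of F)).basicOpen
        (((Spec (CommRingCat.of F)).presheaf.map (homOfLE h).op) (x.1.app V b)) = ⊤ :=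
      Scheme.basicOpen_of_isUnit _ hunit
    rw [Scheme.basicOpen_res, top_inf_eq] at htop
    rw [RatPoint.MemOpen, Scheme.preimage_basicOpen]
    exact htop.ge

theorem RatPoint.exists_regVal_eq_div (x : RatPoint π) {V W : X.Opens} (hV : IsAffineOpen V)
    (hxV : x.MemOpen V) (hxW : x.MemOpen W) (f : Γ(X, W)) :
    ∃ a b : Γ(X, V), regVal π V b x ≠ 0 ∧ ∀ y : RatPoint π, y.MemOpen V → regVal π V b y ≠ 0 →
      y.MemOpen W ∧ regVal π W f y = regVal π V a y / regVal π V b y := by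
  let z : Spec (CommRingCat.of F) := (⊥ : PrimeSpectrum F)
  obtain ⟨b, hbW, hxb⟩ := hV.exists_basicOpen_le ⟨x.1 z, (x.memOpen_iff W z).1 hxW⟩
    ((x.memOpen_iff V z).1 hxV)
  have hbx := (x.memOpen_basicOpen hxV b).1 ((x.memOpen_iff _ z).2 hxb)
  have := hV.isLocalization_basicOpen b
  obtain ⟨k, a, hka⟩ := IsLocalization.Away.surj b (X.presheaf.map (homOfLE hbW).op f)
  -- The denominator is `b ^ (k + 1)`: for `k = 0` the power `b ^ k` would not see the zeros of `b`.
  refine ⟨a * b, b ^ k * b, ?_, fun y hy hyb => ?_⟩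
  · rw [regVal_eq_evalHom x V hxV, map_mul, map_pow]
    exact mul_ne_zero (pow_ne_zero _ hbx) hbx
  simp only [regVal_eq_evalHom y V hy, map_mul, map_pow] at hyb ⊢
  have hyb' : y.evalHom V hy b ≠ 0 := right_ne_zero_of_mul hyb
  have hyB : y.MemOpen (X.basicOpen b) := (y.memOpen_basicOpen hy b).2 hyb'
  refine ⟨hyB.mono hbW, ?_⟩
  have hres (c : Γ(X, V)) : y.evalHom _ hyB (algebraMap Γ(X, V) Γ(X, X.basicOpen b) c) =
      y.evalHom V hy c := y.evalHom_map (homOfLE (X.basicOpen_le b)) hyB c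
  have hquot := congrArg (y.evalHom _ hyB) hka
  rw [map_mul, map_pow, hres, hres, y.evalHom_map] at hquot
  rw [regVal_eq_evalHom y W (hyB.mono hbW), ← hquot]
  field_simp

end Points

section AnalyticTopology

variable {F : Type u} [NontriviallyNormedField F] {X : Scheme.{u}}
  {π : X ⟶ Spec (CommRingCat.of F)}

theorem isOpen_setOf_memOpen (V : X.Opens) : IsOpen {x : RatPoint π | x.MemOpen V} :=
  TopologicalSpace.isOpen_generateFrom_of_mem ⟨V, 0, Set.univ, isOpen_univ, by simp⟩

theorem continuousOn_regVal (V : X.Opens) (f : Γ(X, V)) :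
    ContinuousOn (regVal π V f) {x | x.MemOpen V} := by
  rw [continuousOn_iff']
  intro W hW
  refine ⟨{x | x.MemOpen V ∧ regVal π V f x ∈ W},
    TopologicalSpace.isOpen_generateFrom_of_mem ⟨V, f, W, hW, rfl⟩, ?_⟩
  ext x
  simp only [Set.mem_inter_iff, Set.mem_preimage, Set.mem_ofPred_eq]
  tauto

end AnalyticTopology

section Coordinates

variable {F : Type u} [Field F] {X : Scheme.{u}} {π : X ⟶ Spec (CommRingCat.of F)}
  {V : X.Opens} {κ : Type*} {θ : MvPolynomial κ F →+* Γ(X, V)}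

/-- The coordinates on `V(F)` given by the images in `Γ(X, V)` of the variables of a polynomial
ring. When `θ` is a surjection of `F`-algebras and `V` is affine, this is a closed embedding
of `V` in the affine space `F ^ κ`, read on rational points. -/
def coord (π : X ⟶ Spec (CommRingCat.of F)) (θ : MvPolynomial κ F →+* Γ(X, V)) (x : RatPoint π) :
    κ → F :=
  fun i => regVal π V (θ (MvPolynomial.X i)) x

theorem regVal_eq_eval_coord (hθ : θ.comp MvPolynomial.C = structHom π V) {x : RatPoint π}
    (hx : x.MemOpen V) (p : MvPolynomial κ F) :
    regVal π V (θ p) x = MvPolynomial.eval (coord π θ x) p := by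
  have hcomp : (x.evalHom V hx).comp θ = MvPolynomial.eval (coord π θ x) := by
    refine MvPolynomial.ringHom_ext' ?_ fun i => ?_
    · rw [RingHom.comp_assoc, hθ, x.evalHom_comp_structHom]
      ext c; simp
    · simp [coord, regVal_eq_evalHom x V hx]
  rw [regVal_eq_evalHom x V hx, ← hcomp, RingHom.comp_apply]

theorem injOn_coord (hV : IsAffineOpen V) (hθ : θ.comp MvPolynomial.C = structHom π V)
    (hsurj : Function.Surjective θ) : Set.InjOn (coord π θ) {x | x.MemOpen V} := by
  refine fun x hx y hy hxy => RatPoint.ext_of_evalHom_eq hV hx hy (RingHom.ext fun b => ?_)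
  obtain ⟨p, rfl⟩ := hsurj b
  rw [← regVal_eq_evalHom x V hx, ← regVal_eq_evalHom y V hy, regVal_eq_eval_coord hθ hx,
    regVal_eq_eval_coord hθ hy, hxy]

theorem image_coord (hV : IsAffineOpen V) (hθ : θ.comp MvPolynomial.C = structHom π V)
    (hsurj : Function.Surjective θ) :
    coord π θ '' {x | x.MemOpen V} = MvPolynomial.zeroLocus F (RingHom.ker θ) := by
  ext z
  simp only [MvPolynomial.mem_zeroLocus_iff, MvPolynomial.aeval_eq_eval]
  constructor
  · rintro ⟨x, hx, rfl⟩ p hp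
    rw [← regVal_eq_eval_coord hθ hx, RingHom.mem_ker.1 hp, regVal_eq_evalHom x V hx, map_zero]
  · intro hz
    let e := RingHom.liftOfSurjective θ hsurj ⟨MvPolynomial.eval z, hz⟩
    have he (p : MvPolynomial κ F) : e (θ p) = MvPolynomial.eval z p :=
      RingHom.liftOfRightInverse_comp_apply θ _ _ ⟨MvPolynomial.eval z, hz⟩ p
    obtain ⟨x, hx, hxe⟩ := exists_ratPoint_evalHom_eq (π := π) hV e (by
      ext c
      rw [← hθ, RingHom.comp_apply, RingHom.comp_apply, he]
      simp)
    refine ⟨x, hx, funext fun i => ?_⟩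
    rw [coord, regVal_eq_evalHom x V hx, hxe, he, MvPolynomial.eval_X]

theorem exists_regVal_eq_eval_div (hV : IsAffineOpen V)
    (hθ : θ.comp MvPolynomial.C = structHom π V) (hsurj : Function.Surjective θ) {x : RatPoint π}
    (hxV : x.MemOpen V) {W : X.Opens} (hxW : x.MemOpen W) (f : Γ(X, W)) :
    ∃ a b : MvPolynomial κ F, MvPolynomial.eval (coord π θ x) b ≠ 0 ∧
      ∀ y : RatPoint π, y.MemOpen V → MvPolynomial.eval (coord π θ y) b ≠ 0 → y.MemOpen W ∧
        regVal π W f y =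
          MvPolynomial.eval (coord π θ y) a / MvPolynomial.eval (coord π θ y) b := by
  obtain ⟨a, b, hb, hab⟩ := x.exists_regVal_eq_div hV hxV hxW f
  obtain ⟨a, rfl⟩ := hsurj a
  obtain ⟨b, rfl⟩ := hsurj b
  refine ⟨a, b, by rwa [← regVal_eq_eval_coord hθ hxV], fun y hy => ?_⟩
  rw [← regVal_eq_eval_coord hθ hy, ← regVal_eq_eval_coord hθ hy]
  exact hab y hy

end Coordinates

section CoordinateTopology

variable {F : Type u} [NontriviallyNormedField F] {X : Scheme.{u}}
  {π : X ⟶ Spec (CommRingCat.of F)} {V : X.Opens} {κ : Type*}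
  {θ : MvPolynomial κ F →+* Γ(X, V)}

theorem isEmbedding_domRestrict_coord (hV : IsAffineOpen V)
    (hθ : θ.comp MvPolynomial.C = structHom π V) (hsurj : Function.Surjective θ) :
    IsEmbedding ({x : RatPoint π | x.MemOpen V}.domRestrict (coord π θ)) := by
  refine ⟨isInducing_iff_nhds.2 fun x => le_antisymm ?_ ?_,
    (Set.injOn_iff_injective).1 (injOn_coord hV hθ hsurj)⟩
  · have hcont : ContinuousOn (coord π θ) {x | x.MemOpen V} :=
      continuousOn_pi.2 fun _ => continuousOn_regVal V _
    exact Filter.map_le_iff_le_comap.1 hcont.domRestrict.continuousAt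
  · refine Filter.tendsto_id'.1 (tendsto_subtype_rng.2
      (TopologicalSpace.tendsto_nhds_generateFrom_iff.2 ?_))
    rintro _ ⟨W, f, O, hO, rfl⟩ ⟨hW, hfO⟩
    obtain ⟨a, b, hb, hab⟩ := exists_regVal_eq_eval_div hV hθ hsurj x.2 hW f
    have hcont (p : MvPolynomial κ F) : ContinuousAt (fun z => MvPolynomial.eval z p)
        (coord π θ x) := (MvPolynomial.continuous_eval p).continuousAt
    have hquot := (hcont a).div (hcont b) hb
    have hxO : MvPolynomial.eval (coord π θ x) a / MvPolynomial.eval (coord π θ x) b ∈ O := by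
      rwa [← (hab x x.2 hb).2]
    filter_upwards [Filter.preimage_mem_comap ((hcont b).eventually_ne hb),
      Filter.preimage_mem_comap (hquot.eventually (hO.mem_nhds hxO))] with y hyb hyO
    obtain ⟨hyW, hyf⟩ := hab y y.2 hyb
    exact ⟨hyW, hyf ▸ hyO⟩

theorem analyticAt_regVal_comp [Fintype κ] {E : Type*} [NormedAddCommGroup E] [NormedSpace F E]
    (hV : IsAffineOpen V) (hθ : θ.comp MvPolynomial.C = structHom π V)
    (hsurj : Function.Surjective θ) {γ : E → RatPoint π} {t : E} (hγ : ContinuousAt γ t)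
    (hγV : (γ t).MemOpen V) (hcoord : AnalyticAt F (fun t' => coord π θ (γ t')) t) {W : X.Opens}
    (hγW : (γ t).MemOpen W) (f : Γ(X, W)) : AnalyticAt F (fun t' => regVal π W f (γ t')) t := by
  obtain ⟨a, b, hb, hab⟩ := exists_regVal_eq_eval_div hV hθ hsurj hγV hγW f
  have heval (p : MvPolynomial κ F) :
      AnalyticAt F (fun t' => MvPolynomial.eval (coord π θ (γ t')) p) t :=
    AnalyticAt.comp (g := fun z => MvPolynomial.eval z p) (analyticAt_eval p _) hcoord
  refine ((heval a).div (heval b) hb).congr ?_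
  filter_upwards [hγ.eventually ((isOpen_setOf_memOpen V).mem_nhds hγV),
    (heval b).continuousAt.eventually_ne hb] with t' ht' hbt'
  exact (hab _ ht' hbt').2.symm

end CoordinateTopology

section SliceChart

variable {M E E' T : Type*} [TopologicalSpace M] [Nonempty M] [TopologicalSpace E]
  [TopologicalSpace E'] [TopologicalSpace T]

theorem exists_openPartialHomeomorph_of_slice {S : Set M} (hS : IsOpen S) {c : M → E}
    (hc : IsEmbedding (S.domRestrict c)) (Φ : OpenPartialHomeomorph E E') {i : T → E'} {q : E' → T}
    (hi : Continuous i) (hq : Continuous q) (hqi : Function.LeftInverse q i)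
    (hslice : ∀ z ∈ Φ.source, z ∈ c '' S ↔ Φ z ∈ Set.range i) :
    ∃ ψ : OpenPartialHomeomorph M T, ψ.source = S ∩ c ⁻¹' Φ.source ∧ ψ.target = i ⁻¹' Φ.target ∧
      (∀ x, ψ x = q (Φ (c x))) ∧ ∀ t ∈ ψ.target, c (ψ.symm t) = Φ.symm (i t) := by
  have hcS : ContinuousOn c S := continuousOn_iff_continuous_domRestrict.2 hc.continuous
  have hinj : Set.InjOn c S := Set.injOn_iff_injective.2 hc.injective
  let pt (t : T) : M := Function.invFunOn c S (Φ.symm (i t))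
  have himage {t : T} (ht : i t ∈ Φ.target) : Φ.symm (i t) ∈ c '' S :=
    (hslice _ (Φ.map_target ht)).2 ⟨t, (Φ.right_inv ht).symm⟩
  have hpt {t : T} (ht : i t ∈ Φ.target) : pt t ∈ S := Function.invFunOn_mem (himage ht)
  have hcpt {t : T} (ht : i t ∈ Φ.target) : c (pt t) = Φ.symm (i t) :=
    Function.invFunOn_eq (himage ht)
  have hiq {x : M} (hx : x ∈ S ∩ c ⁻¹' Φ.source) : i (q (Φ (c x))) = Φ (c x) := by
    obtain ⟨t, ht⟩ := (hslice _ hx.2).1 (Set.mem_image_of_mem c hx.1)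
    rw [← ht, hqi t]
  have htarget {x : M} (hx : x ∈ S ∩ c ⁻¹' Φ.source) : i (q (Φ (c x))) ∈ Φ.target :=
    (hiq hx).symm ▸ Φ.map_source hx.2
  refine ⟨
    { toFun := fun x => q (Φ (c x))
      invFun := pt
      source := S ∩ c ⁻¹' Φ.source
      target := i ⁻¹' Φ.target
      map_source' := fun x hx => htarget hx
      map_target' := fun t ht => ⟨hpt ht, by
        rw [Set.mem_preimage, hcpt ht]; exact Φ.map_target ht⟩
      left_inv' := fun x hx => hinj (hpt (htarget hx)) hx.1 (by
        rw [hcpt (htarget hx), hiq hx, Φ.left_inv hx.2])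
      right_inv' := fun t ht => by rw [hcpt ht, Φ.right_inv ht, hqi t]
      open_source := hcS.isOpen_inter_preimage hS Φ.open_source
      open_target := Φ.open_target.preimage hi
      continuousOn_toFun := hq.comp_continuousOn (Φ.continuousOn.comp
        (hcS.mono Set.inter_subset_left) fun x hx => hx.2)
      continuousOn_invFun := ?_ }, rfl, rfl, fun _ => rfl, fun t ht => hcpt ht⟩
  have hlift : Continuous fun t : i ⁻¹' Φ.target => (⟨pt t, hpt t.2⟩ : S) := by
    rw [hc.continuous_iff]
    refine (Φ.continuousOn_symm.comp_continuous (hi.comp continuous_subtype_val)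
      fun t => t.2).congr fun t => (hcpt t.2).symm
  exact continuousOn_iff_continuous_domRestrict.2 (continuous_subtype_val.comp hlift)

end SliceChart

section EtaleChart

theorem analyticAt_sumElim {F σ ι : Type*} [NontriviallyNormedField F] [Fintype σ] [Fintype ι]
    (a : σ → F) (t : ι → F) : AnalyticAt F (Sum.elim a) t :=
  AnalyticAt.pi (Sum.rec (fun _ => analyticAt_const)
    fun i => (ContinuousLinearMap.proj (R := F) (φ := fun _ : ι => F) i).analyticAt t)

theorem mem_zeroLocus_span_range_iff_sumElim_mem_range {F σ ι : Type*} [Field F]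
    (g : σ → MvPolynomial (σ ⊕ ι) F) (z : σ ⊕ ι → F) :
    z ∈ MvPolynomial.zeroLocus F (Ideal.span (Set.range g)) ↔
      Sum.elim (fun j => MvPolynomial.eval z (g j)) (z ∘ Sum.inr) ∈
        Set.range (Sum.elim (0 : σ → F)) := by
  rw [MvPolynomial.zeroLocus_span, Set.mem_ofPred_eq, Set.forall_mem_range]
  simp only [MvPolynomial.aeval_eq_eval, Set.mem_range, Sum.elim_eq_iff]
  exact ⟨fun h => ⟨z ∘ Sum.inr, funext fun j => (h j).symm, rfl⟩,
    fun ⟨_, h, _⟩ j => (congrFun h j).symm⟩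

variable {F : Type u} [NontriviallyNormedField F] [CompleteSpace F] {X : Scheme.{u}}
  {π : X ⟶ Spec (CommRingCat.of F)} {V : X.Opens} {n : ℕ}

theorem exists_analyticChart_of_etale (hV : IsAffineOpen V)
    {τ : MvPolynomial (Fin n) F →+* Γ(X, V)} (hτ : τ.Etale)
    (hτC : τ.comp MvPolynomial.C = structHom π V) {x₀ : RatPoint π} (hx₀ : x₀.MemOpen V) :
    ∃ ψ ∈ analyticCharts π n, x₀ ∈ ψ.source ∧ (∀ x ∈ ψ.source, x.MemOpen V) ∧
      ∀ x, ψ x = coord π τ x := by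
  have : Nonempty (RatPoint π) := ⟨x₀⟩
  obtain ⟨σ, _, _, g, θ, hsurj, hθτ, hker, hJ⟩ := exists_surjective_ker_eq_span_isUnit_jacobian hτ
  have hθ : θ.comp MvPolynomial.C = structHom π V := by
    rw [← hτC, ← hθτ]; ext c; simp
  have hinr (x : RatPoint π) : coord π θ x ∘ Sum.inr = coord π τ x := by
    ext i; simp [coord, ← hθτ]
  obtain ⟨Φ, hΦ₀, hΦ, hΦan⟩ := exists_openPartialHomeomorph_sumElim_eval g (z₀ := coord π θ x₀) (by
    rw [← regVal_eq_eval_coord hθ hx₀, regVal_eq_evalHom x₀ V hx₀]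
    exact (hJ.map (x₀.evalHom V hx₀)).ne_zero)
  have hslice (z : σ ⊕ Fin n → F) (_ : z ∈ Φ.source) :
      z ∈ coord π θ '' {x | x.MemOpen V} ↔ Φ z ∈ Set.range (Sum.elim (0 : σ → F)) := by
    rw [image_coord hV hθ hsurj, hker, mem_zeroLocus_span_range_iff_sumElim_mem_range, hΦ]
  obtain ⟨ψ, hsource, htarget, hψ, hψsymm⟩ := exists_openPartialHomeomorph_of_slice
    (isOpen_setOf_memOpen V) (isEmbedding_domRestrict_coord hV hθ hsurj) Φ
    (i := Sum.elim (0 : σ → F)) (q := fun z => z ∘ Sum.inr)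
    (continuous_iff_continuousAt.2 fun t => (analyticAt_sumElim 0 t).continuousAt) (by fun_prop)
    (fun _ => rfl) hslice
  have hψV {x : RatPoint π} (hx : x ∈ ψ.source) : x.MemOpen V := (hsource ▸ hx).1
  have hψτ (x : RatPoint π) : ψ x = coord π τ x := by rw [hψ, hΦ, Sum.elim_comp_inr, hinr]
  refine ⟨ψ, ⟨fun W f t ht htW => ?_, fun x hx => ?_⟩, hsource ▸ ⟨hx₀, hΦ₀⟩, fun x hx => hψV hx,
    hψτ⟩
  · refine analyticAt_regVal_comp hV hθ hsurj (ψ.continuousAt_symm ht) (hψV (ψ.map_target ht)) ?_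
      htW f
    exact (AnalyticAt.comp (g := Φ.symm) (hΦan _ (htarget.le ht)) (analyticAt_sumElim 0 t)).congr
      (Filter.eventually_of_mem (ψ.open_target.mem_nhds ht) fun t' ht' => (hψsymm t' ht').symm)
  · exact ⟨V, n, fun i => τ (MvPolynomial.X i), id, hψV hx, analyticAt_id,
      Filter.Eventually.of_forall hψτ⟩

end EtaleChart

section Geometry

theorem eq_fromSpec_of_specializes_of_mem_minimalPrimes {X : Scheme.{u}} {V : X.Opens}
    (hV : IsAffineOpen V) (q : PrimeSpectrum Γ(X, V)) (hq : q.asIdeal ∈ minimalPrimes Γ(X, V))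
    {η : X} (hη : η ⤳ hV.fromSpec q) : η = hV.fromSpec q := by
  have hηV : η ∈ V := hη.mem_open V.isOpen (hV.range_fromSpec.le ⟨q, rfl⟩)
  obtain ⟨p, rfl⟩ : η ∈ Set.range hV.fromSpec := hV.range_fromSpec.ge hηV
  have hle : p.asIdeal ≤ q.asIdeal := (PrimeSpectrum.le_iff_specializes p q).2
    (hV.fromSpec.isOpenEmbedding.isInducing.specializes_iff.1 hη)
  exact congrArg hV.fromSpec (PrimeSpectrum.ext (le_antisymm hle (hq.2 ⟨p.isPrime, bot_le⟩ hle)))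

theorem exists_map_notMem_of_mem_minimalPrimes {X : Scheme.{u}} {ι : Type*} (φ : ι → Γ(X, ⊤))
    (hφ : ∀ Z ∈ irreducibleComponents X, ∃ i, ∃ z ∈ Z, z ∈ X.basicOpen (φ i))
    {V : X.Opens} (hV : IsAffineOpen V) {Q : Ideal Γ(X, V)} (hQ : Q ∈ minimalPrimes Γ(X, V)) :
    ∃ i, X.presheaf.map (homOfLE (le_top : V ≤ ⊤)).op (φ i) ∉ Q := by
  let q : PrimeSpectrum Γ(X, V) := ⟨Q, hQ.1.1⟩
  have hirr := isIrreducible_irreducibleComponent (x := hV.fromSpec q)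
  obtain ⟨i, z, hz, hzi⟩ := hφ _ (irreducibleComponent_mem_irreducibleComponents (hV.fromSpec q))
  have hgen := hirr.isGenericPoint_genericPoint isClosed_irreducibleComponent
  have hη : hirr.genericPoint = hV.fromSpec q :=
    eq_fromSpec_of_specializes_of_mem_minimalPrimes hV q hQ
      (hgen.specializes mem_irreducibleComponent)
  have hqi : hV.fromSpec q ∈ X.basicOpen (φ i) :=
    hη ▸ (hgen.mem_open_set_iff (X.basicOpen (φ i)).isOpen).2 ⟨z, hz, hzi⟩
  refine ⟨i, ?_⟩
  have hmem : q ∈ hV.fromSpec ⁻¹ᵁ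
      X.basicOpen (X.presheaf.map (homOfLE (le_top : V ≤ ⊤)).op (φ i)) := by
    rw [Scheme.basicOpen_res]
    exact ⟨hV.range_fromSpec.le ⟨q, rfl⟩, hqi⟩
  rw [hV.fromSpec_preimage_basicOpen] at hmem
  exact hmem

theorem exists_etale_coordinates {F : Type u} [Field F] {X : Scheme.{u}}
    (π : X ⟶ Spec (CommRingCat.of F)) [Smooth π] (x : X) :
    ∃ (V : X.Opens) (n : ℕ) (τ : MvPolynomial (Fin n) F →+* Γ(X, V)), IsAffineOpen V ∧ x ∈ V ∧
      τ.Etale ∧ τ.comp MvPolynomial.C = structHom π V := by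
  obtain ⟨U, hU, V, hV, hxV, hVU, hstandard⟩ := Smooth.exists_isStandardSmooth π x
  obtain rfl : U = ⊤ := by
    refine top_unique fun y _ => ?_
    rw [show y = π x from Subsingleton.elim (α := PrimeSpectrum F) _ _]
    exact hVU hxV
  have hstruct : (structHom π V).IsStandardSmooth :=
    RingHom.isStandardSmooth_respectsIso.2 _
      (Scheme.ΓSpecIso (CommRingCat.of F)).symm.commRingCatIsoToRingEquiv hstandard
  obtain ⟨n, τ, hτC, hτ⟩ := hstruct.exists_etale_mvPolynomial
  exact ⟨V, n, τ, hV, hxV, hτ, hτC⟩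

theorem exists_ne_zero_map_mem_span_of_etale {X : Scheme.{u}} {ι : Type*} (φ : ι → Γ(X, ⊤))
    (hφ : ∀ Z ∈ irreducibleComponents X, ∃ i, ∃ z ∈ Z, z ∈ X.basicOpen (φ i))
    {V : X.Opens} (hV : IsAffineOpen V) {A : Type*} [CommRing A] [IsDomain A]
    {τ : A →+* Γ(X, V)} (hτ : τ.Etale) :
    ∃ a : A, a ≠ 0 ∧
      τ a ∈ Ideal.span (Set.range fun i => X.presheaf.map (homOfLE (le_top : V ≤ ⊤)).op (φ i)) := by
  let := τ.toAlgebra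
  have : Algebra.Etale A Γ(X, V) := hτ
  refine exists_ne_zero_algebraMap_mem _ fun Q hQ hle => ?_
  obtain ⟨i, hi⟩ := exists_map_notMem_of_mem_minimalPrimes φ hφ hV hQ
  exact hi (hle (Ideal.subset_span ⟨i, rfl⟩))

end Geometry

section UltrametricBound

variable {F ι : Type*} [NormedField F] [IsUltrametricDist F] [Fintype ι]

theorem iInf_enorm_rpow_neg_le (c f : ι → F) {C : ℝ≥0} (hC : 0 < C) (hcC : ∀ i, ‖c i‖ₑ ≤ C) {s : ℝ}
    (hs : 0 < s) : ⨅ i, ‖f i‖ₑ ^ (-s) ≤ (C : ℝ≥0∞) ^ s * ‖∑ i, c i * f i‖ₑ ^ (-s) := by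
  have hC0 : (C : ℝ≥0∞) ≠ 0 := ENNReal.coe_ne_zero.2 hC.ne'
  rcases isEmpty_or_nonempty ι with _ | _
  · simp [hs, hC.ne']
  obtain ⟨i, -, hi⟩ := IsUltrametricDist.exists_norm_finsetSum_le_of_nonempty
    Finset.univ_nonempty fun i => c i * f i
  have hsum : ‖∑ i, c i * f i‖ₑ ≤ C * ‖f i‖ₑ :=
    calc ‖∑ i, c i * f i‖ₑ ≤ ‖c i * f i‖ₑ := enorm_le_iff_norm_le.2 hi
      _ = ‖c i‖ₑ * ‖f i‖ₑ := enorm_mul _ _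
      _ ≤ C * ‖f i‖ₑ := by gcongr; exact hcC i
  calc ⨅ i, ‖f i‖ₑ ^ (-s) ≤ ‖f i‖ₑ ^ (-s) := iInf_le _ i
    _ = (C : ℝ≥0∞) ^ s * (C * ‖f i‖ₑ) ^ (-s) := by
        rw [ENNReal.mul_rpow_of_ne_top ENNReal.coe_ne_top enorm_ne_top, ← mul_assoc,
          ← ENNReal.rpow_add _ _ hC0 ENNReal.coe_ne_top, add_neg_cancel, ENNReal.rpow_zero, one_mul]
    _ ≤ (C : ℝ≥0∞) ^ s * ‖∑ i, c i * f i‖ₑ ^ (-s) := by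
        gcongr 1
        rw [ENNReal.rpow_neg, ENNReal.rpow_neg, ENNReal.inv_le_inv]
        exact ENNReal.rpow_le_rpow hsum hs.le

theorem exists_iInf_enorm_rpow_neg_le_of_isCompact {M : Type*} [TopologicalSpace M] {K : Set M}
    (hK : IsCompact K) {c : ι → M → F} (hc : ∀ i, ContinuousOn (c i) K) (f : ι → M → F) :
    ∃ C : ℝ≥0, ∀ s : ℝ, 0 < s → ∀ x ∈ K,
      ⨅ i, ‖f i x‖ₑ ^ (-s) ≤ (C : ℝ≥0∞) ^ s * ‖∑ i, c i x * f i x‖ₑ ^ (-s) := by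
  obtain ⟨B, hB⟩ := hK.exists_bound_of_continuousOn (continuousOn_pi.2 hc)
  refine ⟨B.toNNReal + 1, fun s hs x hx => ?_⟩
  refine iInf_enorm_rpow_neg_le (fun i => c i x) (fun i => f i x) (by positivity) (fun i => ?_) hs
  have hi : ‖c i x‖₊ ≤ B.toNNReal :=
    NNReal.le_toNNReal_of_coe_le ((norm_le_pi_norm (fun j => c j x) i).trans (hB x hx))
  exact ENNReal.coe_le_coe.2 (hi.trans le_self_add)

end UltrametricBound

section SmoothMeasures

theorem aemeasurable_of_ae_mem_source {M N : Type*} [TopologicalSpace M] [MeasurableSpace M]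
    [OpensMeasurableSpace M] [TopologicalSpace N] [MeasurableSpace N] [BorelSpace N]
    {μ : Measure M} {ψ : OpenPartialHomeomorph M N} (hψ : ∀ᵐ x ∂μ, x ∈ ψ.source) :
    AEMeasurable ψ μ :=
  Measure.restrict_eq_self_of_ae_mem hψ ▸
    ψ.continuousOn.aemeasurable ψ.open_source.measurableSet

variable {F : Type u} [NontriviallyNormedField F] [LocallyCompactSpace F] [MeasurableSpace F]
  [BorelSpace F] {M : Type v} [TopologicalSpace M] [MeasurableSpace M] [OpensMeasurableSpace M]
  {μ : Measure M} {A : ∀ n : ℕ, Set (OpenPartialHomeomorph M (Fin n → F))} {n : ℕ}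
  {ψ : OpenPartialHomeomorph M (Fin n → F)} {K : Set M}

theorem exists_map_le_smul_haar_restrict (hμ : IsSmoothMeasure A μ) (hψ : ψ ∈ A n)
    (hK : IsCompact K) (hKψ : K ⊆ ψ.source) (hμK : ∀ᵐ x ∂μ, x ∈ K) :
    ∃ C : ℝ≥0, μ.map ψ ≤ C • (haar F n).restrict (ψ '' K) := by
  have : ProperSpace F := ProperSpace.of_locallyCompactSpace F
  have hsource : ∀ᵐ x ∂μ, x ∈ ψ.source := hμK.mono fun _ hx => hKψ hx
  obtain ⟨ρ, hρ, hmap⟩ := hμ n ψ hψ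
  rw [Measure.restrict_eq_self_of_ae_mem hsource] at hmap
  have hcompact : IsCompact (ψ '' K) := hK.image_of_continuousOn (ψ.continuousOn.mono hKψ)
  have htarget : ψ '' K ⊆ ψ.target := Set.image_subset_iff.2 fun x hx => ψ.map_source (hKψ hx)
  have hρc : ContinuousOn ρ (ψ '' K) := fun y hy =>
    (continuousAt_const.congr ((hρ y (htarget hy)).mono fun _ h => h.symm)).continuousWithinAt
  obtain ⟨C, hC⟩ := (hcompact.image_of_continuousOn hρc).bddAbove
  have himage : ∀ᵐ y ∂μ.map ψ, y ∈ ψ '' K :=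
    (ae_map_iff (aemeasurable_of_ae_mem_source hsource) hcompact.measurableSet).2
      (hμK.mono fun _ hx => Set.mem_image_of_mem ψ hx)
  refine ⟨C, ?_⟩
  calc μ.map ψ = (μ.map ψ).restrict (ψ '' K) := (Measure.restrict_eq_self_of_ae_mem himage).symm
    _ = ((haar F n).restrict (ψ '' K)).withDensity fun y => (ρ y : ℝ≥0∞) := by
        rw [hmap, restrict_withDensity hcompact.measurableSet,
          Measure.restrict_restrict hcompact.measurableSet, Set.inter_eq_left.2 htarget]
    _ ≤ ((haar F n).restrict (ψ '' K)).withDensity fun _ => (C : ℝ≥0∞) :=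
        withDensity_mono ((ae_restrict_iff' hcompact.measurableSet).2 (.of_forall fun y hy =>
          ENNReal.coe_le_coe.2 (hC (Set.mem_image_of_mem ρ hy))))
    _ = C • (haar F n).restrict (ψ '' K) := withDensity_const _

theorem lintegral_lt_top_of_isSmoothMeasure (hμ : IsSmoothMeasure A μ) (hψ : ψ ∈ A n)
    (hK : IsCompact K) (hKψ : K ⊆ ψ.source) (hμK : ∀ᵐ x ∂μ, x ∈ K) {f : M → ℝ≥0∞}
    {h : (Fin n → F) → ℝ≥0∞} (hh : Measurable h) (hfh : ∀ x ∈ K, f x ≤ h (ψ x))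
    (hint : ∫⁻ y in ψ '' K, h y ∂(haar F n) < ∞) : ∫⁻ x, f x ∂μ < ∞ := by
  have : ProperSpace F := ProperSpace.of_locallyCompactSpace F
  obtain ⟨C, hC⟩ := exists_map_le_smul_haar_restrict hμ hψ hK hKψ hμK
  calc ∫⁻ x, f x ∂μ ≤ ∫⁻ x, h (ψ x) ∂μ := lintegral_mono_ae (hμK.mono hfh)
    _ = ∫⁻ y, h y ∂μ.map ψ := (lintegral_map' hh.aemeasurable
        (aemeasurable_of_ae_mem_source (hμK.mono fun _ hx => hKψ hx))).symm
    _ ≤ ∫⁻ y, h y ∂(C • (haar F n).restrict (ψ '' K)) := lintegral_mono' hC le_rfl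
    _ = C * ∫⁻ y in ψ '' K, h y ∂(haar F n) := lintegral_smul_measure _ _
    _ < ∞ := ENNReal.mul_lt_top ENNReal.coe_lt_top hint

end SmoothMeasures

section LocalIntegrability

variable {F : Type u} {X : Scheme.{u}} {V : X.Opens}

theorem regVal_sum_mul_map [Field F] {π : X ⟶ Spec (CommRingCat.of F)} {x : RatPoint π}
    (hx : x.MemOpen V) {ι : Type*} [Fintype ι] (c : ι → Γ(X, V)) (φ : ι → Γ(X, ⊤)) :
    regVal π V (∑ i, c i * X.presheaf.map (homOfLE (le_top : V ≤ ⊤)).op (φ i)) x =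
      ∑ i, regVal π V (c i) x * regVal π ⊤ (φ i) x := by
  simp only [regVal_eq_evalHom x V hx, regVal_eq_evalHom x ⊤ x.memOpen_top, map_sum, map_mul,
    x.evalHom_map]

variable [NontriviallyNormedField F] [IsUltrametricDist F] [LocallyCompactSpace F]
  [MeasurableSpace F] [BorelSpace F] {π : X ⟶ Spec (CommRingCat.of F)} {n r : ℕ}

theorem eventually_integrableNear_of_etale (φ : Fin r → Γ(X, ⊤))
    (hφ : ∀ Z ∈ irreducibleComponents X, ∃ i, ∃ z ∈ Z, z ∈ X.basicOpen (φ i))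
    (hV : IsAffineOpen V) {τ : MvPolynomial (Fin n) F →+* Γ(X, V)} (hτ : τ.Etale)
    (hτC : τ.comp MvPolynomial.C = structHom π V) :
    ∀ᶠ s : ℝ≥0 in 𝓝[>] 0, ∀ x₀ : RatPoint π, x₀.MemOpen V →
      IntegrableNear (analyticCharts π) (fun i => regVal π ⊤ (φ i)) x₀ s := by
  have : ProperSpace F := ProperSpace.of_locallyCompactSpace F
  obtain ⟨a, ha, haφ⟩ := exists_ne_zero_map_mem_span_of_etale φ hφ hV hτ
  obtain ⟨c, hc⟩ := Ideal.mem_span_range_iff_exists_fun.1 haφ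
  filter_upwards [eventually_setLIntegral_haar_eval_rpow_neg_lt_top ha, self_mem_nhdsWithin]
    with s hint hs x₀ hx₀
  obtain ⟨ψ, hψ, hx₀ψ, hψV, hψτ⟩ := exists_analyticChart_of_etale hV hτ hτC hx₀
  refine ⟨ψ.source, ψ.open_source, hx₀ψ, fun μ hμ ⟨K, hK, hKψ, hμK⟩ => ?_⟩
  have hKV (x : RatPoint π) (hx : x ∈ K) : x.MemOpen V := hψV x (hKψ hx)
  obtain ⟨C, hC⟩ := exists_iInf_enorm_rpow_neg_le_of_isCompact hK
    (fun i => (continuousOn_regVal V (c i)).mono hKV) fun i => regVal π ⊤ (φ i)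
  have hsum (x : RatPoint π) (hx : x ∈ K) :
      ∑ i, regVal π V (c i) x * regVal π ⊤ (φ i) x = MvPolynomial.eval (ψ x) a := by
    rw [← regVal_sum_mul_map (hKV x hx), hc, regVal_eq_eval_coord hτC (hKV x hx), hψτ]
  refine lintegral_lt_top_of_isSmoothMeasure hμ hψ hK hKψ hμK
    ((measurable_enorm_eval_rpow a (-(s : ℝ))).const_mul ((C : ℝ≥0∞) ^ (s : ℝ)))
    (fun x hx => hsum x hx ▸ hC s hs x hx) ?_
  rw [lintegral_const_mul _ (measurable_enorm_eval_rpow a _)]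
  exact ENNReal.mul_lt_top (ENNReal.rpow_lt_top_of_nonneg s.2 ENNReal.coe_ne_top)
    (hint _ (hK.image_of_continuousOn (ψ.continuousOn.mono hKψ)))

theorem eventually_integrableNear [Smooth π] [QuasiCompact π] (φ : Fin r → Γ(X, ⊤))
    (hφ : ∀ Z ∈ irreducibleComponents X, ∃ i, ∃ z ∈ Z, z ∈ X.basicOpen (φ i)) :
    ∀ᶠ s : ℝ≥0 in 𝓝[>] 0, ∀ x₀ : RatPoint π,
      IntegrableNear (analyticCharts π) (fun i => regVal π ⊤ (φ i)) x₀ s := by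
  have : CompactSpace X := QuasiCompact.compactSpace_of_compactSpace π
  choose V n τ hV hxV hτ hτC using exists_etale_coordinates π
  obtain ⟨t, ht⟩ := isCompact_univ.elim_finite_subcover (fun x : X => (V x : Set X))
    (fun x => (V x).isOpen) fun x _ => Set.mem_iUnion.2 ⟨x, hxV x⟩
  filter_upwards [(Filter.eventually_all_finset t).2 fun x _ =>
    eventually_integrableNear_of_etale φ hφ (hV x) (hτ x) (hτC x)] with s hs x₀
  let z : Spec (CommRingCat.of F) := (⊥ : PrimeSpectrum F)
  obtain ⟨x, hxt, hx⟩ := Set.mem_iUnion₂.1 (ht (Set.mem_univ (x₀.1 z)))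
  exact hs x hxt x₀ ((x₀.memOpen_iff _ z).2 hx)

end LocalIntegrability

end AnalyticLct

end

theorem theorem2_general {F : Type u} [NontriviallyNormedField F] [IsUltrametricDist F]
    [LocallyCompactSpace F] [MeasurableSpace F] [BorelSpace F]
    {X : Scheme.{u}} (π : X ⟶ Spec (CommRingCat.of F))
    [Smooth π] [QuasiCompact π]
    {r : ℕ} (φ : Fin r → Γ(X, ⊤))
    (hφ : ∀ Z ∈ irreducibleComponents X, ∃ i, ∃ z ∈ Z, z ∈ X.basicOpen (φ i)) :
    ∃ ε : ℝ≥0, 0 < ε ∧ ∀ x₀ : AnalyticLct.RatPoint π,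
      (ε : ℝ≥0∞) < AnalyticLct.lct (AnalyticLct.analyticCharts π)
        (fun i => AnalyticLct.regVal π ⊤ (φ i)) x₀ := by
  obtain ⟨s, hint, hs⟩ :=
    ((AnalyticLct.eventually_integrableNear (π := π) φ hφ).and self_mem_nhdsWithin).exists
  obtain ⟨ε, hε, hεs⟩ := exists_between (show 0 < s from hs)
  exact ⟨ε, hε, fun x₀ =>
    (ENNReal.coe_lt_coe.2 hεs).trans_le (le_sSup ⟨s, hint x₀, rfl⟩)⟩

/-- `F` is a non-Archimedean local field with an absolute value, `π : X ⟶ Spec F` a smooth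
`F`-variety, and `φ` a finite family of regular functions on `X` which do not simultaneously
vanish identically on any irreducible component of `X`. -/
theorem theorem2 {F : Type u} [NontriviallyNormedField F] [IsUltrametricDist F]
    [LocallyCompactSpace F] [MeasurableSpace F] [BorelSpace F]
    {X : Scheme.{u}} (π : X ⟶ Spec (CommRingCat.of F))
    [Smooth π] [IsSeparated π] [QuasiCompact π]
    {r : ℕ} (φ : Fin r → Γ(X, ⊤))
    (hφ : ∀ Z ∈ irreducibleComponents X, ∃ i, ∃ z ∈ Z, z ∈ X.basicOpen (φ i)) :
    ∃ ε : ℝ≥0, 0 < ε ∧ ∀ x₀ : AnalyticLct.RatPoint π,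
      (ε : ℝ≥0∞) < AnalyticLct.lct (AnalyticLct.analyticCharts π)
        (fun i => AnalyticLct.regVal π ⊤ (φ i)) x₀ :=
  theorem2_general π φ hφ
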